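/- Let $L(x)=\dfrac{2\,(x-\log(1+x))}{x^2}$ for real $x>-1$, $x\neq 0$, and $L(0)=1$ (the normalized left truncated logarithm), so that $L(x)=2\sum_{j\ge 0}\dfrac{(-1)^j x^j}{j+2}$ for $|x|<1$. For every $k\ge 0$ the function $L^{-\frac{2k+1}{2}}$ is real analytic at $0$, and the factorial has the asymptotic expansion $$n!\;\asymp\;\sqrt{2\pi n}\;e^{-n}\,n^n\sum_{k\ge 0}\frac{a_k}{n^k},\qquad a_k=\frac{1}{2^k\,k!}\,\partial^{2k}\Big(L^{-\frac{2k+1}{2}}\Big)(0),$$ where $\partial^{m} f$ denotes the $m$-th derivative of $f$. That is, for every $N\ge 0$ one has, for all integers $n\ge 1$, $n!=\sqrt{2\pi n}\,e^{-n}n^n\Big(\sum_{k=0}^{N}\frac{a_k}{n^k}+R_{N+1}(n)\Big)$ with $R_{N+1}(n)=O\big(n^{-(N+1)}\big)$ as $n\to\infty$. Moreover these are the only real numbers $a_k$ $(k\ge 0)$ for which this holds. -/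

import Mathlib

open Filter Asymptotics
open scoped Nat Topology

/-- The normalized left truncated logarithm `L x = 2 (x - log (1 + x)) / x ^ 2` (`x > -1`, `x ≠ 0`),
with its removable singularity at `0` filled in by `L 0 = 1`. -/
noncomputable def truncLog (x : ℝ) : ℝ :=
  if x = 0 then 1 else 2 * (x - Real.log (1 + x)) / x ^ 2

/-- `a` is the sequence of coefficients of an asymptotic expansion
`n! ≍ √(2πn) e⁻ⁿ nⁿ ∑ₖ aₖ / nᵏ`: for every `N ≥ 0`,
`n! = √(2πn) e⁻ⁿ nⁿ (∑_{k=0}^{N} aₖ / nᵏ + R n)` for all `n ≥ 1`, with `R n = O(1 / n^(N+1))`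
as `n → ∞`. -/
def IsFactorialExpansion (a : ℕ → ℝ) : Prop :=
  ∀ N : ℕ, ∃ R : ℕ → ℝ,
    (∀ n : ℕ, 1 ≤ n →
      (n ! : ℝ) = Real.sqrt (2 * Real.pi * n) * Real.exp (-(n : ℝ)) * (n : ℝ) ^ n *
        ((∑ k ∈ Finset.range (N + 1), 1 / (n : ℝ) ^ k * a k) + R n)) ∧
    R =O[atTop] fun n : ℕ => 1 / (n : ℝ) ^ (N + 1)

/-! This is Laplace's method with an explicit change of variable. Rescaling the Gamma integral gives
n! = n·nⁿe⁻ⁿ ∫_{x>-1} exp(-n(x - log(1+x))) dx. With u = L^{1/2} and φ(x) = x·u(x), the phase x -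
log(1+x) equals φ²/2, so φ turns the integral into a Gaussian one.

No inverse of φ is constructed. Lagrange inversion is used in the form 1 = ∑_{k<M} c_k φ^k φ' +
O(x^M) near 0, where c_k is the coefficient of x^k in u^{-(k+1)}
(`exists_expansion_taylorCoeffZero`). Substituting y = φ(x) turns the sum into Gaussian moments: odd
ones vanish, and the 2k-th has a factor (2k)! that cancels the Taylor denominator, leaving a_k.

All errors (local remainder, tail in x, tail in y) are bounded by M-th moments of size
O(n^{-(M+1)/2}); see `exists_abs_integral_exp_sub_integral_le`. Uniqueness is the usual induction on
the order. -/

/-! ### The truncated logarithm: series, analyticity, positivity. -/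

theorem hasSum_truncLog {x : ℝ} (hx : |x| < 1) :
    HasSum (fun j : ℕ => 2 * ((-1 : ℝ) ^ j * x ^ j / ((j : ℝ) + 2))) (truncLog x) := by
  unfold truncLog
  split_ifs with h0
  · subst h0
    convert hasSum_ite_eq (0 : ℕ) (1 : ℝ) using 2 with j
    rcases j with _ | j <;> simp
  · have h := Real.hasSum_pow_div_log_of_abs_lt_one (x := -x) (by rwa [abs_neg])
    rw [← hasSum_nat_add_iff' 1] at h
    have e : 2 * (x - Real.log (1 + x)) / x ^ 2 = 2 / x ^ 2 * (-Real.log (1 - -x) -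
        ∑ i ∈ Finset.range 1, (-x) ^ (i + 1) / ((i : ℝ) + 1)) := by
      simp
      ring
    rw [e]
    refine Eq.subst (motive := fun f => HasSum f _) (funext fun j => ?_) (h.mul_left (2 / x ^ 2))
    have hj : (j : ℝ) + 2 ≠ 0 := by positivity
    have hp : (-x) ^ (j + 1 + 1) = (-1) ^ j * x ^ j * x ^ 2 := by
      rw [neg_pow]; ring
    have hc : ((j + 1 : ℕ) : ℝ) + 1 = j + 2 := by push_cast; ring
    rw [hp, hc]
    field_simp

theorem analyticAt_truncLog : AnalyticAt ℝ truncLog 0 := by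
  refine HasFPowerSeriesAt.analyticAt (p := FormalMultilinearSeries.ofScalars ℝ
    fun j : ℕ => 2 * ((-1 : ℝ) ^ j / ((j : ℝ) + 2))) ⟨1, ⟨?_, one_pos, ?_⟩⟩
  · have := FormalMultilinearSeries.le_radius_of_bound (r := 1) (FormalMultilinearSeries.ofScalars ℝ
      fun j : ℕ => 2 * ((-1 : ℝ) ^ j / ((j : ℝ) + 2))) 1 (fun n => by
        rw [FormalMultilinearSeries.ofScalars_norm]
        have h2 : (0 : ℝ) < n + 2 := by positivity
        simp [abs_of_pos h2]
        rw [← div_eq_mul_inv, div_le_one h2]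
        linarith [(Nat.cast_nonneg n : (0 : ℝ) ≤ n)])
    simpa using this
  · intro y hy
    have hy' : |y| < 1 := by simpa [enorm_eq_nnnorm, ← NNReal.coe_lt_coe] using hy
    rw [zero_add]
    refine Eq.subst (motive := fun f => HasSum f _) (funext fun j => ?_) (hasSum_truncLog hy')
    simp
    ring

theorem truncLog_zero : truncLog 0 = 1 := by simp [truncLog]

theorem sub_log_pos {x : ℝ} (hx : -1 < x) (h0 : x ≠ 0) : 0 < x - Real.log (1 + x) := by
  have := Real.log_lt_sub_one_of_pos (x := 1 + x) (by linarith) (by simpa using h0)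
  linarith

theorem truncLog_pos {x : ℝ} (hx : -1 < x) : 0 < truncLog x := by
  unfold truncLog
  split_ifs with h0
  · exact one_pos
  · have := sub_log_pos hx h0
    positivity

theorem sq_mul_truncLog (x : ℝ) : x ^ 2 * truncLog x = 2 * (x - Real.log (1 + x)) := by
  unfold truncLog
  split_ifs with h0
  · simp [h0]
  · field_simp

theorem AnalyticAt.rpow_const_of_pos {f : ℝ → ℝ} {x : ℝ} (hf : AnalyticAt ℝ f x) (hx : 0 < f x)
    (r : ℝ) : AnalyticAt ℝ (fun y => f y ^ r) x := by
  have h : AnalyticAt ℝ (fun y => Real.exp (Real.log (f y) * r)) x :=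
    ((hf.log hx).mul analyticAt_const).rexp
  refine h.congr ?_
  filter_upwards [hf.continuousAt.eventually (lt_mem_nhds hx)] with y hy
  rw [Real.rpow_def_of_pos hy]

theorem AnalyticAt.exists_eventuallyEq_mul {f : ℝ → ℝ} (hf : AnalyticAt ℝ f 0) (h0 : f 0 = 0) :
    ∃ g : ℝ → ℝ, AnalyticAt ℝ g 0 ∧ f =ᶠ[𝓝 0] fun x => x * g x := by
  have h := (natCast_le_analyticOrderAt hf (n := 1)).1 (by
    rw [Nat.cast_one, Order.one_le_iff_ne_zero, Ne, hf.analyticOrderAt_eq_zero]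
    simpa using h0)
  simpa [EventuallyEq] using h

/-! ### Calculus of Taylor coefficients at 0. -/

/-- The `m`-th Taylor coefficient at `0`. -/
noncomputable def taylorCoeffZero (m : ℕ) (f : ℝ → ℝ) : ℝ := iteratedDeriv m f 0 / m !

theorem taylorCoeffZero_congr {f g : ℝ → ℝ} (h : f =ᶠ[𝓝 0] g) (m : ℕ) :
    taylorCoeffZero m f = taylorCoeffZero m g := by
  rw [taylorCoeffZero, taylorCoeffZero, h.iteratedDeriv_eq]

theorem taylorCoeffZero_sum {ι : Type*} (s : Finset ι) (c : ι → ℝ) {f : ι → ℝ → ℝ}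
    (hf : ∀ i, AnalyticAt ℝ (f i) 0) (m : ℕ) :
    taylorCoeffZero m (fun x => ∑ i ∈ s, c i * f i x) = ∑ i ∈ s, c i * taylorCoeffZero m (f i) := by
  unfold taylorCoeffZero
  rw [iteratedDeriv_fun_sum fun i _ => contDiffAt_const.mul (hf i).contDiffAt, Finset.sum_div]
  refine Finset.sum_congr rfl fun i _ => ?_
  rw [iteratedDeriv_const_mul _ (hf i).contDiffAt, mul_div_assoc]

theorem taylorCoeffZero_add {f g : ℝ → ℝ} (hf : AnalyticAt ℝ f 0) (hg : AnalyticAt ℝ g 0) (m : ℕ) :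
    taylorCoeffZero m (fun x => f x + g x) = taylorCoeffZero m f + taylorCoeffZero m g := by
  unfold taylorCoeffZero
  rw [iteratedDeriv_fun_add hf.contDiffAt hg.contDiffAt, add_div]

theorem taylorCoeffZero_const_mul {f : ℝ → ℝ} (hf : AnalyticAt ℝ f 0) (c : ℝ) (m : ℕ) :
    taylorCoeffZero m (fun x => c * f x) = c * taylorCoeffZero m f := by
  unfold taylorCoeffZero
  rw [iteratedDeriv_const_mul _ hf.contDiffAt, mul_div_assoc]

theorem taylorCoeffZero_zero (f : ℝ → ℝ) : taylorCoeffZero 0 f = f 0 := by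
  simp [taylorCoeffZero]

theorem iteratedDeriv_succ_id_mul {f : ℝ → ℝ} (hf : AnalyticAt ℝ f 0) (m : ℕ) :
    iteratedDeriv (m + 1) (fun x => x * f x) 0 = (m + 1) * iteratedDeriv m f 0 := by
  rw [iteratedDeriv_fun_mul (f := fun x => x) contDiffAt_fun_id hf.contDiffAt, Finset.sum_eq_single 1]
  · simp
  · intro b _ hb
    have : iteratedDeriv b (fun x : ℝ => x) 0 = 0 := by
      rcases b with _ | _ | b
      · simp
      · simp at hb
      · have h1 : deriv (fun x : ℝ => x) = fun _ => 1 := by funext; simp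
        rw [iteratedDeriv_succ', h1, iteratedDeriv_succ', deriv_const']
        simp
    simp [this]
  · simp

theorem taylorCoeffZero_succ_id_mul {f : ℝ → ℝ} (hf : AnalyticAt ℝ f 0) (m : ℕ) :
    taylorCoeffZero (m + 1) (fun x => x * f x) = taylorCoeffZero m f := by
  unfold taylorCoeffZero
  rw [iteratedDeriv_succ_id_mul hf, Nat.factorial_succ]
  push_cast
  field_simp

theorem taylorCoeffZero_pow_mul_of_lt {f : ℝ → ℝ} (hf : AnalyticAt ℝ f 0) {m k : ℕ} (h : m < k) :
    taylorCoeffZero m (fun x => x ^ k * f x) = 0 := by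
  induction m generalizing k with
  | zero => rw [taylorCoeffZero_zero]; simp [h.ne']
  | succ m ih =>
    obtain ⟨k, rfl⟩ : ∃ l, k = l + 1 := ⟨k - 1, by omega⟩
    simp_rw [pow_succ', mul_assoc]
    rw [taylorCoeffZero_succ_id_mul (by fun_prop), ih (by omega)]

theorem taylorCoeffZero_pow_mul_add {f : ℝ → ℝ} (hf : AnalyticAt ℝ f 0) (m k : ℕ) :
    taylorCoeffZero (m + k) (fun x => x ^ k * f x) = taylorCoeffZero m f := by
  induction k with
  | zero => simp
  | succ k ih =>
    simp_rw [pow_succ', mul_assoc]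
    rw [← add_assoc, taylorCoeffZero_succ_id_mul (by fun_prop), ih]

theorem taylorCoeffZero_id_mul_deriv {f : ℝ → ℝ} (hf : AnalyticAt ℝ f 0) (m : ℕ) :
    taylorCoeffZero m (fun x => x * deriv f x) = m * taylorCoeffZero m f := by
  rcases m with _ | m
  · simp [taylorCoeffZero_zero]
  · rw [taylorCoeffZero_succ_id_mul hf.deriv]
    unfold taylorCoeffZero
    rw [iteratedDeriv_succ', Nat.factorial_succ]
    push_cast
    field_simp

/-! ### Lagrange inversion without the inverse function. -/

/-- Residue computation behind Lagrange inversion: with `φ x = x * u x`, the coefficient of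
`x ^ m` in `(φ x / x)⁻¹ ^ (m + 1) * φ x ^ k * φ' x` is `1` for `k = m` and `0` otherwise. -/
theorem taylorCoeffZero_inv_pow_mul_deriv {u : ℝ → ℝ} (hu : AnalyticAt ℝ u 0) (h0 : u 0 ≠ 0)
    (m k : ℕ) :
    taylorCoeffZero m (fun x => (u x)⁻¹ ^ (m + 1) * ((x * u x) ^ k * (u x + x * deriv u x)))
      = if k = m then 1 else 0 := by
  have hi : AnalyticAt ℝ (fun x => (u x)⁻¹) 0 := hu.inv h0
  have hd := hu.deriv
  have hne : ∀ᶠ x in 𝓝 (0 : ℝ), u x ≠ 0 := hu.continuousAt.eventually_ne h0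
  have hda : ∀ᶠ x in 𝓝 (0 : ℝ), AnalyticAt ℝ u x := hu.eventually_analyticAt
  rcases lt_or_ge m k with h | h
  · rw [if_neg h.ne', ← taylorCoeffZero_pow_mul_of_lt
      (f := fun x => (u x)⁻¹ ^ (m + 1) * (u x ^ k * (u x + x * deriv u x))) (by fun_prop) h]
    congr 1; funext x; ring
  · obtain ⟨j, rfl⟩ : ∃ j, m = j + k := ⟨m - k, by omega⟩
    have e : taylorCoeffZero (j + k)
        (fun x => (u x)⁻¹ ^ (j + k + 1) * ((x * u x) ^ k * (u x + x * deriv u x)))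
        = taylorCoeffZero j (fun x => (u x)⁻¹ ^ (j + 1) * (u x + x * deriv u x)) := by
      rw [← taylorCoeffZero_pow_mul_add (m := j) (k := k) (by fun_prop)]
      apply taylorCoeffZero_congr
      filter_upwards [hne] with x hx
      simp only [inv_pow]
      field_simp
      ring
    rw [e]
    rcases eq_or_ne j 0 with rfl | hj
    · simp [taylorCoeffZero_zero, h0]
    · rw [if_neg (by omega)]
      have hj' : (j : ℝ) ≠ 0 := by exact_mod_cast hj
      have hw : AnalyticAt ℝ (fun x => (u x)⁻¹ ^ j) 0 := by fun_prop
      have hwd := hw.deriv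
      -- With w = u⁻ʲ, the function is w - x·w'/j. Since x·d/dx multiplies the j-th coefficient by
      -- j, the two contributions cancel.
      have e2 : taylorCoeffZero j (fun x => (u x)⁻¹ ^ (j + 1) * (u x + x * deriv u x))
          = taylorCoeffZero j (fun x => (u x)⁻¹ ^ j +
            (-1 / (j : ℝ)) * (x * deriv (fun x => (u x)⁻¹ ^ j) x)) := by
        apply taylorCoeffZero_congr
        filter_upwards [hne, hda] with x hx hxa
        have hD := (hxa.differentiableAt.hasDerivAt.fun_inv hx).fun_pow j
        rw [hD.deriv]
        obtain ⟨i, rfl⟩ : ∃ i, j = i + 1 := ⟨j - 1, by omega⟩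
        simp only [Nat.add_sub_cancel, inv_pow]
        field_simp
        ring
      rw [e2, taylorCoeffZero_add hw (by fun_prop), taylorCoeffZero_const_mul (by fun_prop),
        taylorCoeffZero_id_mul_deriv hw]
      field_simp
      ring

/-- Repeated division by φ = x·u: subtracting from the remainder f the multiple of φ' with the same
value at 0 leaves x·g = φ·(g/u). -/
theorem exists_expansion_in_powers {u : ℝ → ℝ} (hu : AnalyticAt ℝ u 0) (h0 : u 0 ≠ 0) (M : ℕ) :
    ∃ (c : ℕ → ℝ) (f : ℝ → ℝ), AnalyticAt ℝ f 0 ∧ ∀ᶠ x in 𝓝 (0 : ℝ),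
      1 = ∑ k ∈ Finset.range M, c k * ((x * u x) ^ k * (u x + x * deriv u x))
        + (x * u x) ^ M * f x := by
  have hd := hu.deriv
  induction M with
  | zero => exact ⟨0, fun _ => 1, analyticAt_const, by simp⟩
  | succ M ih =>
    obtain ⟨c, f, hf, hcf⟩ := ih
    obtain ⟨g, hg, hfg⟩ := AnalyticAt.exists_eventuallyEq_mul
      (f := fun x => f x - f 0 / u 0 * (u x + x * deriv u x)) (by fun_prop) (by simp [h0])
    refine ⟨fun k => if k = M then f 0 / u 0 else c k, fun x => g x * (u x)⁻¹,
      hg.mul (hu.inv h0), ?_⟩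
    filter_upwards [hcf, hfg, hu.continuousAt.eventually_ne h0] with x h1 h2 hx
    rw [Finset.sum_range_succ, h1, add_assoc]
    congr 1
    · refine Finset.sum_congr rfl fun k hk => ?_
      rw [if_neg (Finset.mem_range.1 hk).ne]
    · rw [if_pos rfl, eq_add_of_sub_eq h2]
      field_simp
      ring

theorem exists_expansion_taylorCoeffZero {u : ℝ → ℝ} (hu : AnalyticAt ℝ u 0) (h0 : u 0 ≠ 0)
    (M : ℕ) :
    ∃ f : ℝ → ℝ, AnalyticAt ℝ f 0 ∧ ∀ᶠ x in 𝓝 (0 : ℝ),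
      1 = ∑ k ∈ Finset.range M, taylorCoeffZero k (fun x => (u x)⁻¹ ^ (k + 1)) *
          ((x * u x) ^ k * (u x + x * deriv u x)) + (x * u x) ^ M * f x := by
  have hd := hu.deriv
  have hi : AnalyticAt ℝ (fun x => (u x)⁻¹) 0 := hu.inv h0
  obtain ⟨c, f, hf, hcf⟩ := exists_expansion_in_powers hu h0 M
  refine ⟨f, hf, ?_⟩
  -- The unknown c m is isolated by multiplying the expansion by u^{-(m+1)} and reading off the
  -- coefficient of x^m; the remainder carries x^M with M > m.
  suffices h : ∀ m ∈ Finset.range M, taylorCoeffZero m (fun x => (u x)⁻¹ ^ (m + 1)) = c m by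
    filter_upwards [hcf] with x hx
    refine hx.trans ?_
    congr 1
    exact Finset.sum_congr rfl fun k hk => by rw [h k hk]
  intro m hm
  have e : taylorCoeffZero m (fun x => (u x)⁻¹ ^ (m + 1)) = taylorCoeffZero m (fun x =>
      ∑ k ∈ Finset.range M, c k *
        ((u x)⁻¹ ^ (m + 1) * ((x * u x) ^ k * (u x + x * deriv u x))) +
      x ^ M * ((u x)⁻¹ ^ (m + 1) * u x ^ M * f x)) := by
    apply taylorCoeffZero_congr
    filter_upwards [hcf] with x hx
    calc (u x)⁻¹ ^ (m + 1) = (u x)⁻¹ ^ (m + 1) * 1 := (mul_one _).symm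
      _ = _ := by
        nth_rewrite 1 [hx]
        rw [mul_add, Finset.mul_sum]
        congr 1
        · exact Finset.sum_congr rfl fun k _ => by ring
        · ring
  rw [e, taylorCoeffZero_add (Finset.analyticAt_fun_sum _ fun k _ => by fun_prop) (by fun_prop),
    taylorCoeffZero_pow_mul_of_lt (by fun_prop) (Finset.mem_range.1 hm),
    taylorCoeffZero_sum _ _ fun k => by fun_prop]
  simp only [taylorCoeffZero_inv_pow_mul_deriv hu h0]
  rw [Finset.sum_eq_single m] <;> simp_all

/-! ### Integral representation, phase bounds and moments. -/

open MeasureTheory Set in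
theorem factorial_eq_integral_exp {n : ℕ} (hn : 1 ≤ n) :
    (n ! : ℝ) = (n : ℝ) * (n : ℝ) ^ n * Real.exp (-(n : ℝ)) *
      ∫ x in Ioi (-1 : ℝ), Real.exp (-(n * (x - Real.log (1 + x)))) := by
  have hn0 : (0 : ℝ) < n := by exact_mod_cast hn
  have hshift : ∫ x in Ioi (-1 : ℝ), Real.exp (-(n * (x - Real.log (1 + x)))) =
      ∫ y in Ioi (0 : ℝ), Real.exp (-(n * (y - 1 - Real.log y))) := by
    rw [← (measurePreserving_add_left volume (1 : ℝ)).setIntegral_preimage_emb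
      (measurableEmbedding_addLeft 1) (fun y => Real.exp (-(n * (y - 1 - Real.log y)))) (Ioi 0)]
    have : (fun x : ℝ => 1 + x) ⁻¹' Ioi 0 = Ioi (-1) := by
      ext x; simp only [mem_preimage, mem_Ioi]; constructor <;> intro h <;> linarith
    rw [this]
    refine setIntegral_congr_fun measurableSet_Ioi fun x _ => ?_
    simp
  rw [hshift, ← Real.Gamma_nat_eq_factorial, Real.Gamma_eq_integral (by positivity)]
  have hs := integral_comp_mul_left_Ioi
    (fun t : ℝ => Real.exp (-t) * t ^ ((n : ℝ) + 1 - 1)) 0 hn0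
  rw [mul_zero, smul_eq_mul, inv_mul_eq_div, eq_div_iff hn0.ne'] at hs
  rw [← hs, mul_comm, mul_assoc, mul_assoc]
  congr 1
  rw [← mul_assoc, ← integral_const_mul]
  refine setIntegral_congr_fun measurableSet_Ioi fun y hy => ?_
  have hy : 0 < y := hy
  have e : Real.exp (-(n * (y - 1 - Real.log y))) =
      Real.exp (-(n * y)) * Real.exp n * y ^ n := by
    rw [← Real.exp_log (pow_pos hy n), Real.log_pow, ← Real.exp_add, ← Real.exp_add]
    congr 1; ring
  have e2 : Real.exp (-(n : ℝ)) * Real.exp n = 1 := by rw [← Real.exp_add]; simp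
  simp only [add_sub_cancel_right, Real.rpow_natCast]
  rw [e]
  linear_combination (-(n : ℝ) ^ n * Real.exp (-(n * y)) * y ^ n) * e2

/-- With s = √(1+x), log s ≤ s - 1 gives x - log(1+x) ≥ (s-1)², and x² = (s-1)²(s+1)² with (s+1)² ≤
2(s²+1) = 2(x+2). -/
theorem div_le_sub_log {x : ℝ} (hx : -1 < x) :
    x ^ 2 / (2 * (x + 2)) ≤ x - Real.log (1 + x) := by
  obtain ⟨s, hs, hsx⟩ : ∃ s : ℝ, 0 < s ∧ s ^ 2 = 1 + x :=
    ⟨√(1 + x), Real.sqrt_pos.2 (by linarith), Real.sq_sqrt (by linarith)⟩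
  have hl := Real.log_le_sub_one_of_pos hs
  rw [← hsx, Real.log_pow]
  have hxs : x = s ^ 2 - 1 := by linarith
  rw [div_le_iff₀ (by linarith)]
  have h1 : (s - 1) ^ 2 ≤ x - (2 : ℕ) * Real.log s := by push_cast; nlinarith
  have h2 : x ^ 2 ≤ (s - 1) ^ 2 * (2 * (x + 2)) := by
    subst hxs
    nlinarith [sq_nonneg ((s - 1) * (s - 1))]
  exact h2.trans (mul_le_mul_of_nonneg_right h1 (by linarith))

/-- The phase is at least x²/6 for x ≤ 1 and at least x/6 for x ≥ 1, so a Gaussian plus an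
exponential tail dominates. -/
theorem exp_neg_mul_sub_log_le {t x : ℝ} (ht : 0 ≤ t) (hx : -1 < x) :
    Real.exp (-(t * (x - Real.log (1 + x)))) ≤
      Real.exp (-(t / 6) * x ^ 2) + (Set.Ioi (0 : ℝ)).indicator (fun x => Real.exp (-(t / 6 * x))) x := by
  have h := div_le_sub_log hx
  rcases le_total x 1 with h1 | h1
  · have : x ^ 2 / 6 ≤ x ^ 2 / (2 * (x + 2)) :=
      div_le_div_of_nonneg_left (sq_nonneg x) (by linarith) (by linarith)
    have h3 : Real.exp (-(t * (x - Real.log (1 + x)))) ≤ Real.exp (-(t / 6) * x ^ 2) := by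
      apply Real.exp_le_exp.2
      nlinarith [mul_le_mul_of_nonneg_left (this.trans h) ht]
    have h4 : 0 ≤ (Set.Ioi (0 : ℝ)).indicator (fun x => Real.exp (-(t / 6 * x))) x :=
      Set.indicator_nonneg (fun _ _ => (Real.exp_pos _).le) _
    linarith
  · rw [Set.indicator_of_mem (Set.mem_Ioi.2 (by linarith))]
    have : x / 6 ≤ x ^ 2 / (2 * (x + 2)) := by
      rw [div_le_div_iff₀ (by norm_num) (by linarith)]
      nlinarith
    have h3 : Real.exp (-(t * (x - Real.log (1 + x)))) ≤ Real.exp (-(t / 6 * x)) := by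
      apply Real.exp_le_exp.2
      nlinarith [mul_le_mul_of_nonneg_left (this.trans h) ht]
    linarith [Real.exp_pos (-(t / 6) * x ^ 2)]

theorem integrable_pow_mul_exp_neg_mul_sq {b : ℝ} (hb : 0 < b) (m : ℕ) :
    MeasureTheory.Integrable fun x : ℝ => x ^ m * Real.exp (-b * x ^ 2) := by
  simpa using integrable_rpow_mul_exp_neg_mul_sq hb (s := m)
    (by linarith [(Nat.cast_nonneg m : (0 : ℝ) ≤ m)])

theorem sqrt_pow_mul_integral_pow_mul_exp {t : ℝ} (ht : 0 < t) (b : ℝ) (m : ℕ) :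
    √t ^ (m + 1) * ∫ x : ℝ, x ^ m * Real.exp (-(t * b) * x ^ 2) =
      ∫ x : ℝ, x ^ m * Real.exp (-b * x ^ 2) := by
  have hs : 0 < √t := Real.sqrt_pos.2 ht
  have h := MeasureTheory.Measure.integral_comp_mul_left
    (fun x : ℝ => x ^ m * Real.exp (-b * x ^ 2)) (√t)
  rw [abs_of_pos (inv_pos.2 hs), smul_eq_mul, inv_mul_eq_div, eq_div_iff hs.ne'] at h
  rw [← h, pow_succ, mul_right_comm, ← MeasureTheory.integral_const_mul]
  congr 2
  funext x
  rw [mul_pow, mul_pow, Real.sq_sqrt ht.le]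
  ring_nf

open MeasureTheory Set in
theorem integrableOn_pow_mul_exp_neg_mul {b : ℝ} (hb : 0 < b) (m : ℕ) :
    IntegrableOn (fun x : ℝ => x ^ m * Real.exp (-(b * x))) (Ioi 0) := by
  have := integrableOn_rpow_mul_exp_neg_mul_rpow (p := 1) (s := m) (b := b)
    (by linarith [(Nat.cast_nonneg m : (0 : ℝ) ≤ m)]) one_pos hb
  simpa using this

open MeasureTheory Set in
theorem pow_mul_integral_Ioi_pow_mul_exp {t : ℝ} (ht : 0 < t) (b : ℝ) (m : ℕ) :
    t ^ (m + 1) * ∫ x in Ioi (0 : ℝ), x ^ m * Real.exp (-(t * b * x)) =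
      ∫ x in Ioi (0 : ℝ), x ^ m * Real.exp (-(b * x)) := by
  have h := integral_comp_mul_left_Ioi (fun x : ℝ => x ^ m * Real.exp (-(b * x))) 0 ht
  rw [mul_zero, smul_eq_mul, inv_mul_eq_div, eq_div_iff ht.ne'] at h
  rw [← h, pow_succ, mul_right_comm, ← integral_const_mul]
  congr 2
  funext x
  ring_nf

open MeasureTheory Set in
theorem integrableOn_pow_mul_exp_neg_mul_sub_log {t : ℝ} (ht : 0 < t) {m : ℕ} (hm : Even m) :
    IntegrableOn (fun x : ℝ => x ^ m * Real.exp (-(t * (x - Real.log (1 + x))))) (Ioi (-1)) := by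
  have ht6 : 0 < t / 6 := by positivity
  have hg := ((integrable_pow_mul_exp_neg_mul_sq ht6 m).add
    ((integrableOn_pow_mul_exp_neg_mul ht6 m).integrable_indicator measurableSet_Ioi)).integrableOn
      (s := Ioi (-1))
  refine hg.mono' (Measurable.aestronglyMeasurable (by fun_prop)) ?_
  refine (ae_restrict_iff' measurableSet_Ioi).2 (.of_forall fun x hx => ?_)
  rw [Real.norm_of_nonneg (mul_nonneg (hm.pow_nonneg x) (Real.exp_pos _).le), Pi.add_apply,
    indicator_mul_right, ← mul_add]
  exact mul_le_mul_of_nonneg_left (exp_neg_mul_sub_log_le ht.le hx) (hm.pow_nonneg x)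

open MeasureTheory Set in
theorem exists_sqrt_pow_mul_integral_le {m : ℕ} (hm : Even m) :
    ∃ C : ℝ, ∀ t : ℝ, 1 ≤ t → √t ^ (m + 1) *
      ∫ x in Ioi (-1 : ℝ), x ^ m * Real.exp (-(t * (x - Real.log (1 + x)))) ≤ C := by
  refine ⟨(∫ x : ℝ, x ^ m * Real.exp (-(1 / 6) * x ^ 2)) +
    ∫ x in Ioi (0 : ℝ), x ^ m * Real.exp (-(1 / 6 * x)), fun t ht => ?_⟩
  have ht0 : 0 < t := by linarith
  have ht6 : 0 < t / 6 := by positivity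
  have i1 := integrable_pow_mul_exp_neg_mul_sq ht6 m
  have i2 := (integrableOn_pow_mul_exp_neg_mul ht6 m).integrable_indicator measurableSet_Ioi
  have hle : ∫ x in Ioi (-1 : ℝ), x ^ m * Real.exp (-(t * (x - Real.log (1 + x)))) ≤
      (∫ x : ℝ, x ^ m * Real.exp (-(t / 6) * x ^ 2)) +
        ∫ x in Ioi (0 : ℝ), x ^ m * Real.exp (-(t / 6 * x)) := by
    rw [← integral_indicator measurableSet_Ioi (s := Ioi 0), ← integral_add i1 i2]
    refine (setIntegral_mono_on (integrableOn_pow_mul_exp_neg_mul_sub_log ht0 hm)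
      (i1.add i2).integrableOn measurableSet_Ioi fun x hx => ?_).trans
      (setIntegral_le_integral (i1.add i2) (.of_forall fun x => ?_))
    · rw [Pi.add_apply, indicator_mul_right, ← mul_add]
      exact mul_le_mul_of_nonneg_left (exp_neg_mul_sub_log_le ht0.le hx) (hm.pow_nonneg x)
    · exact add_nonneg (mul_nonneg (hm.pow_nonneg x) (Real.exp_pos _).le)
        (indicator_nonneg (fun x _ => mul_nonneg (hm.pow_nonneg x) (Real.exp_pos _).le) _)
  refine (mul_le_mul_of_nonneg_left hle (by positivity)).trans ?_
  rw [mul_add, div_eq_mul_one_div t 6, sqrt_pow_mul_integral_pow_mul_exp ht0,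
    ← pow_mul_integral_Ioi_pow_mul_exp ht0 (1 / 6)]
  -- The exponential tail decays like t^{-(m+1)}, faster than needed, because √t ≤ t for t ≥ 1.
  gcongr
  · exact setIntegral_nonneg measurableSet_Ioi
      fun x _ => mul_nonneg (hm.pow_nonneg x) (Real.exp_pos _).le
  · exact Real.sqrt_le_iff.2 ⟨ht0.le, by nlinarith⟩

theorem integral_odd_pow_mul_exp_neg_mul_sq (b : ℝ) {m : ℕ} (hm : Odd m) :
    ∫ x : ℝ, x ^ m * Real.exp (-b * x ^ 2) = 0 := by
  have h := MeasureTheory.integral_neg_eq_self (fun x : ℝ => x ^ m * Real.exp (-b * x ^ 2))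
    MeasureTheory.volume
  simp only [hm.neg_pow, neg_sq, neg_mul, MeasureTheory.integral_neg] at h ⊢
  linarith

theorem factorial_two_mul_eq (k : ℕ) : (2 * k)! = (2 * k - 1)‼ * (2 ^ k * k !) := by
  rcases k with _ | k
  · simp
  · rw [← Nat.doubleFactorial_two_mul, mul_comm (_‼), show 2 * (k + 1) = 2 * k + 1 + 1 by ring,
      Nat.factorial_eq_mul_doubleFactorial]
    simp

open MeasureTheory Set in
theorem integral_even_pow_mul_exp_neg_sq_div_two (k : ℕ) :
    ∫ x : ℝ, x ^ (2 * k) * Real.exp (-(1 / 2) * x ^ 2) =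
      √(2 * Real.pi) * ((2 * k)! / (2 ^ k * k !)) := by
  have h := integral_rpow_mul_exp_neg_mul_rpow (p := 2) (q := (2 * k : ℕ)) (b := 1 / 2) two_pos
    (by linarith [(Nat.cast_nonneg (2 * k) : (0 : ℝ) ≤ _)]) (by norm_num)
  have habs := integral_comp_abs (f := fun x : ℝ => x ^ (2 * k) * Real.exp (-(1 / 2) * x ^ 2))
  simp only [pow_mul, sq_abs] at habs
  simp only [pow_mul]
  rw [habs]
  simp only [Real.rpow_natCast, Real.rpow_ofNat, pow_mul] at h
  rw [h, show (((2 * k : ℕ) : ℝ) + 1) / 2 = k + 1 / 2 by push_cast; ring, Real.Gamma_nat_add_half,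
    show -(((2 * k : ℕ) : ℝ) + 1) / 2 = -(k + 1 / 2 : ℝ) by push_cast; ring, one_div (2 : ℝ),
    Real.inv_rpow (by norm_num), Real.rpow_neg (by norm_num), inv_inv, Real.rpow_add (by norm_num),
    Real.rpow_natCast, ← one_div (2 : ℝ), ← Real.sqrt_eq_rpow, factorial_two_mul_eq,
    Real.sqrt_mul (by norm_num)]
  push_cast
  field_simp

/-! ### Localization and error estimates. -/

theorem exists_forall_abs_le_abs_sub_le {u : ℝ → ℝ} (hu : AnalyticAt ℝ u 0) (h0 : 0 < u 0) (M : ℕ) :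
    ∃ δ : ℝ, 0 < δ ∧ δ < 1 ∧ ∃ C : ℝ, ∀ x : ℝ, |x| ≤ δ → AnalyticAt ℝ u x ∧ 0 < u x ∧
      |1 - ∑ k ∈ Finset.range M, taylorCoeffZero k (fun x => (u x)⁻¹ ^ (k + 1)) *
          ((x * u x) ^ k * (u x + x * deriv u x))| ≤ C * |x| ^ M := by
  obtain ⟨f, hf, hfe⟩ := exists_expansion_taylorCoeffZero hu h0.ne' M
  have hg : AnalyticAt ℝ (fun x => u x ^ M * f x) 0 := by fun_prop
  obtain ⟨δ, hδ, h⟩ := Metric.nhds_basis_closedBall.eventually_iff.1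
    (((hu.eventually_analyticAt.and (hu.continuousAt.eventually (lt_mem_nhds h0))).and hfe).and
      (hg.continuousAt.norm.eventually (gt_mem_nhds (lt_add_one _))))
  refine ⟨min δ (1 / 2), by positivity, by linarith [min_le_right δ (1 / 2)],
    ‖u 0 ^ M * f 0‖ + 1, fun x hx => ?_⟩
  obtain ⟨⟨⟨h1, h2⟩, h3⟩, h4⟩ := h (x := x) (by simpa using hx.trans (min_le_left _ _))
  refine ⟨h1, h2, ?_⟩
  nth_rewrite 1 [h3]
  rw [add_sub_cancel_left, mul_pow, mul_assoc, abs_mul, abs_pow, mul_comm]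
  exact mul_le_mul_of_nonneg_right h4.le (by positivity)

theorem abs_sum_mul_pow_le {η : ℝ} (hη : 0 < η) (c : ℕ → ℝ) (M : ℕ) :
    ∃ C : ℝ, ∀ y : ℝ, η ≤ |y| → |∑ k ∈ Finset.range M, c k * y ^ k| ≤ C * |y| ^ M := by
  refine ⟨∑ k ∈ Finset.range M, |c k| / η ^ (M - k), fun y hy => ?_⟩
  rw [Finset.sum_mul]
  refine (Finset.abs_sum_le_sum_abs _ _).trans (Finset.sum_le_sum fun k hk => ?_)
  rw [abs_mul, abs_pow, div_mul_eq_mul_div, le_div_iff₀ (by positivity), mul_assoc]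
  refine mul_le_mul_of_nonneg_left ?_ (abs_nonneg _)
  have hkM : k + (M - k) = M := by have := Finset.mem_range.1 hk; omega
  calc |y| ^ k * η ^ (M - k) ≤ |y| ^ k * |y| ^ (M - k) := by gcongr
    _ = |y| ^ M := by rw [← pow_add, hkM]

-- Outside an interval around 0 a polynomial of degree below M is at most C|y|^M, so completing the
-- Gaussian integral to the whole line costs only an M-th moment.
open MeasureTheory Set in
theorem exists_abs_integral_sub_setIntegral_le {a b : ℝ} (ha : a < 0) (hb : 0 < b) (c : ℕ → ℝ)
    {M : ℕ} (hM : Even M) :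
    ∃ C : ℝ, ∀ t : ℝ, 1 ≤ t → √t ^ (M + 1) *
      |(∫ y in Ioc a b, (∑ k ∈ Finset.range M, c k * y ^ k) * Real.exp (-(t * (1 / 2)) * y ^ 2)) -
        ∫ y : ℝ, (∑ k ∈ Finset.range M, c k * y ^ k) * Real.exp (-(t * (1 / 2)) * y ^ 2)| ≤ C := by
  obtain ⟨C, hC⟩ := abs_sum_mul_pow_le (lt_min (neg_pos.2 ha) hb) c M
  refine ⟨C * ∫ y : ℝ, y ^ M * Real.exp (-(1 / 2) * y ^ 2), fun t ht => ?_⟩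
  have ht0 : 0 < t := by linarith
  have hint : Integrable fun y : ℝ =>
      (∑ k ∈ Finset.range M, c k * y ^ k) * Real.exp (-(t * (1 / 2)) * y ^ 2) := by
    simp_rw [Finset.sum_mul, mul_assoc (c _)]
    exact integrable_finsetSum _ fun k _ =>
      (integrable_pow_mul_exp_neg_mul_sq (by positivity) k).const_mul _
  have hM' := (integrable_pow_mul_exp_neg_mul_sq (b := t * (1 / 2)) (by positivity) M).const_mul |C|
  have hC0 : 0 ≤ C := by
    have := (abs_nonneg _).trans (hC (max (-a) b) (by
      rw [abs_of_pos (lt_max_of_lt_right hb)]; exact min_le_max))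
    exact nonneg_of_mul_nonneg_left this (pow_pos (abs_pos.2 (lt_max_of_lt_right hb).ne') M)
  rw [abs_of_nonneg hC0] at hM'
  rw [← sqrt_pow_mul_integral_pow_mul_exp ht0, mul_left_comm]
  refine mul_le_mul_of_nonneg_left ?_ (by positivity)
  rw [← integral_add_compl (measurableSet_Ioc (a := a) (b := b)) hint, sub_add_cancel_left, abs_neg,
    ← integral_const_mul]
  refine le_trans ?_ (setIntegral_le_integral (s := (Ioc a b)ᶜ) hM' (.of_forall fun y =>
    mul_nonneg hC0 (mul_nonneg (hM.pow_nonneg y) (Real.exp_pos _).le)))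
  rw [← Real.norm_eq_abs]
  refine norm_integral_le_of_norm_le hM'.integrableOn ?_
  refine (ae_restrict_iff' measurableSet_Ioc.compl).2 (.of_forall fun y hy => ?_)
  have hy' : min (-a) b ≤ |y| := by
    simp only [mem_compl_iff, mem_Ioc, not_and_or, not_lt, not_le] at hy
    rcases hy with hy | hy
    · exact (min_le_left _ _).trans (by rw [abs_of_neg (by linarith)]; linarith)
    · exact (min_le_right _ _).trans (by rw [abs_of_pos (by linarith)]; linarith)
  rw [norm_mul, Real.norm_eq_abs, Real.norm_of_nonneg (Real.exp_pos _).le, ← mul_assoc,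
    ← hM.pow_abs]
  exact mul_le_mul_of_nonneg_right (hC y hy') (Real.exp_pos _).le

theorem exp_neg_mul_sub_log_eq {x : ℝ} (hx : -1 < x) (t : ℝ) :
    Real.exp (-(t * (x - Real.log (1 + x)))) =
      Real.exp (-(t * (1 / 2)) * (x * truncLog x ^ (1 / 2 : ℝ)) ^ 2) := by
  have h := sq_mul_truncLog x
  have h2 : (truncLog x ^ (1 / 2 : ℝ)) ^ 2 = truncLog x := by
    rw [← Real.sqrt_eq_rpow, Real.sq_sqrt (truncLog_pos hx).le]
  rw [mul_pow, h2, h]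
  ring_nf

open MeasureTheory Set in
theorem exists_abs_integral_exp_sub_integral_le {M : ℕ} (hM : Even M) :
    ∃ C : ℝ, ∀ t : ℝ, 1 ≤ t → √t ^ (M + 1) *
      |(∫ x in Ioi (-1 : ℝ), Real.exp (-(t * (x - Real.log (1 + x))))) -
        ∫ y : ℝ, (∑ k ∈ Finset.range M,
          taylorCoeffZero k (fun x => (truncLog x ^ (1 / 2 : ℝ))⁻¹ ^ (k + 1)) * y ^ k) *
            Real.exp (-(t * (1 / 2)) * y ^ 2)| ≤ C := by
  set u : ℝ → ℝ := fun x => truncLog x ^ (1 / 2 : ℝ) with hu_def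
  have hu : AnalyticAt ℝ u 0 := analyticAt_truncLog.rpow_const_of_pos (by simp [truncLog_zero]) _
  obtain ⟨δ, hδ, hδ1, C₀, hloc⟩ :=
    exists_forall_abs_le_abs_sub_le hu (by simp [hu_def, truncLog_zero]) M
  set c : ℕ → ℝ := fun k => taylorCoeffZero k (fun x => (u x)⁻¹ ^ (k + 1)) with hc
  change ∃ C : ℝ, ∀ t : ℝ, 1 ≤ t → √t ^ (M + 1) *
      |(∫ x in Ioi (-1 : ℝ), Real.exp (-(t * (x - Real.log (1 + x))))) -
        ∫ y : ℝ, (∑ k ∈ Finset.range M, c k * y ^ k) * Real.exp (-(t * (1 / 2)) * y ^ 2)| ≤ C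
  have hmem : ∀ x ∈ Icc (-δ) δ, |x| ≤ δ := fun x hx => abs_le.2 hx
  have ha : -δ * u (-δ) < 0 :=
    mul_neg_of_neg_of_pos (by linarith) (hloc (-δ) (by rw [abs_neg, abs_of_pos hδ])).2.1
  have hb : 0 < δ * u δ := mul_pos hδ (hloc δ (by rw [abs_of_pos hδ])).2.1
  obtain ⟨C₁, hC₁⟩ := exists_abs_integral_sub_setIntegral_le ha hb c hM
  obtain ⟨C₂, hC₂⟩ := exists_sqrt_pow_mul_integral_le hM
  -- C₀ handles |x| ≤ δ through the local expansion; 1/δ^M handles the rest, where 1 ≤ |x|^M/δ^M.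
  set A : ℝ := max C₀ (1 / δ ^ M) with hA
  have hA0 : 0 ≤ A := (by positivity : (0 : ℝ) ≤ 1 / δ ^ M).trans (le_max_right _ _)
  refine ⟨A * C₂ + C₁, fun t ht => ?_⟩
  have ht0 : 0 < t := by linarith
  set w : ℝ → ℝ := fun x => Real.exp (-(t * (x - Real.log (1 + x)))) with hw
  set φ' : ℝ → ℝ := fun x => u x + x * deriv u x with hφ'
  set P : ℝ → ℝ := fun y => ∑ k ∈ Finset.range M, c k * y ^ k with hP
  have hPc : Continuous P := by fun_prop
  have hucont : ContinuousOn u (Icc (-δ) δ) :=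
    fun x hx => (hloc x (hmem x hx)).1.continuousAt.continuousWithinAt
  have hφ'cont : ContinuousOn φ' (Icc (-δ) δ) := fun x hx =>
    ((hloc x (hmem x hx)).1.continuousAt.add
      (continuousAt_id.mul (hloc x (hmem x hx)).1.deriv.continuousAt)).continuousWithinAt
  set F : ℝ → ℝ := fun x => P (x * u x) * Real.exp (-(t * (1 / 2)) * (x * u x) ^ 2) * φ' x with hF
  have hFcont : ContinuousOn F (Icc (-δ) δ) := by
    have h1 : ContinuousOn (fun x => x * u x) (Icc (-δ) δ) := continuousOn_id.mul hucont
    have h2 : Continuous fun y => P y * Real.exp (-(t * (1 / 2)) * y ^ 2) := by fun_prop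
    exact (h2.comp_continuousOn h1).mul hφ'cont
  have hFint : IntegrableOn F (Ioc (-δ) δ) :=
    (hFcont.integrableOn_compact isCompact_Icc).mono_set Ioc_subset_Icc_self
  have hsubst : ∫ x in Ioc (-δ) δ, F x =
      ∫ y in Ioc (-δ * u (-δ)) (δ * u δ), P y * Real.exp (-(t * (1 / 2)) * y ^ 2) := by
    rw [← intervalIntegral.integral_of_le (by linarith),
      ← intervalIntegral.integral_of_le (by linarith)]
    refine intervalIntegral.integral_comp_mul_deriv (f := fun x => x * u x) (f' := φ')
      (g := fun y => P y * Real.exp (-(t * (1 / 2)) * y ^ 2)) (fun x hx => ?_) ?_ (by fun_prop)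
    · rw [uIcc_of_le (by linarith)] at hx
      have := (hasDerivAt_id' x).fun_mul (hloc x (hmem x hx)).1.differentiableAt.hasDerivAt
      rwa [one_mul] at this
    · rwa [uIcc_of_le (by linarith)]
  have hIoc : Ioi (-1 : ℝ) ∩ Ioc (-δ) δ = Ioc (-δ) δ :=
    inter_eq_right.2 fun x hx => mem_Ioi.2 (by linarith [hx.1])
  have hwint : IntegrableOn w (Ioi (-1)) := by
    simpa using integrableOn_pow_mul_exp_neg_mul_sub_log ht0 (m := 0) (by simp)
  have hdiff : |(∫ x in Ioi (-1 : ℝ), w x) - ∫ x in Ioc (-δ) δ, F x| ≤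
      A * ∫ x in Ioi (-1 : ℝ), x ^ M * w x := by
    rw [← hIoc, ← setIntegral_indicator measurableSet_Ioc, ← integral_sub hwint
      (hFint.integrable_indicator measurableSet_Ioc).integrableOn, ← integral_const_mul]
    rw [← Real.norm_eq_abs]
    refine norm_integral_le_of_norm_le
      ((integrableOn_pow_mul_exp_neg_mul_sub_log ht0 hM).const_mul A) ?_
    refine (ae_restrict_iff' measurableSet_Ioi).2 (.of_forall fun x hx => ?_)
    rw [← mul_assoc, Real.norm_eq_abs, ← hM.pow_abs]
    have hw0 : 0 < w x := Real.exp_pos _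
    by_cases hxδ : x ∈ Ioc (-δ) δ
    · have hl := (hloc x (hmem x (Ioc_subset_Icc_self hxδ))).2.2
      have e : w x - F x = (1 - ∑ k ∈ Finset.range M, c k * ((x * u x) ^ k * φ' x)) * w x := by
        have : w x = Real.exp (-(t * (1 / 2)) * (x * u x) ^ 2) := exp_neg_mul_sub_log_eq hx t
        simp only [hF, ← this, hP, ← mul_assoc, ← Finset.sum_mul]
        ring
      rw [indicator_of_mem hxδ, e, abs_mul, abs_of_pos hw0]
      refine mul_le_mul_of_nonneg_right (hl.trans ?_) hw0.le
      exact mul_le_mul_of_nonneg_right (le_max_left _ _) (by positivity)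
    · rw [indicator_of_notMem hxδ, sub_zero, abs_of_pos hw0]
      refine le_mul_of_one_le_left hw0.le ?_
      have hx' : δ ≤ |x| := by
        simp only [mem_Ioc, not_and_or, not_lt, not_le] at hxδ
        rcases hxδ with h | h
        · rw [abs_of_neg (by linarith)]; linarith
        · rw [abs_of_pos (by linarith)]; linarith
      calc (1 : ℝ) = 1 / δ ^ M * δ ^ M := by field_simp
        _ ≤ A * |x| ^ M := by gcongr; exact le_max_right _ _
  have h1 := hC₁ t ht
  rw [← hsubst] at h1
  have h2 := mul_le_mul_of_nonneg_left (hC₂ t ht) hA0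
  have h3 := mul_le_mul_of_nonneg_left hdiff (by positivity : 0 ≤ √t ^ (M + 1))
  have h4 := mul_le_mul_of_nonneg_left (abs_sub_le (∫ x in Ioi (-1 : ℝ), w x)
    (∫ x in Ioc (-δ) δ, F x) (∫ y : ℝ, P y * Real.exp (-(t * (1 / 2)) * y ^ 2)))
    (by positivity : 0 ≤ √t ^ (M + 1))
  rw [mul_add] at h4
  rw [mul_left_comm] at h3
  linarith

/-! ### Identification of the coefficients; existence and uniqueness. -/

/-- The coefficients of the expansion of `n!`, as derivatives of powers of `truncLog`. -/
noncomputable def factorialCoeff (k : ℕ) : ℝ :=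
  1 / (2 ^ k * (k ! : ℝ)) *
    iteratedDeriv (2 * k) (fun x : ℝ => truncLog x ^ (-((2 * (k : ℝ) + 1) / 2))) 0

theorem taylorCoeffZero_inv_sqrt_truncLog_pow (k : ℕ) :
    taylorCoeffZero (2 * k) (fun x => (truncLog x ^ (1 / 2 : ℝ))⁻¹ ^ (2 * k + 1)) *
      ((2 * k)! / (2 ^ k * k !)) = factorialCoeff k := by
  have h : taylorCoeffZero (2 * k) (fun x => (truncLog x ^ (1 / 2 : ℝ))⁻¹ ^ (2 * k + 1)) =
      taylorCoeffZero (2 * k) (fun x => truncLog x ^ (-((2 * (k : ℝ) + 1) / 2))) := by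
    apply taylorCoeffZero_congr
    filter_upwards [lt_mem_nhds (by norm_num : (-1 : ℝ) < 0)] with x hx
    have hp := (truncLog_pos hx).le
    rw [← Real.rpow_neg hp, ← Real.rpow_natCast, ← Real.rpow_mul hp]
    congr 1
    push_cast
    ring
  rw [h, taylorCoeffZero, factorialCoeff]
  field_simp

theorem sum_range_two_mul_of_odd_eq_zero {f : ℕ → ℝ} (hf : ∀ k, Odd k → f k = 0) (n : ℕ) :
    ∑ k ∈ Finset.range (2 * n), f k = ∑ k ∈ Finset.range n, f (2 * k) := by
  induction n with
  | zero => simp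
  | succ n ih =>
    rw [mul_add, mul_one, Finset.sum_range_succ, Finset.sum_range_succ, ih,
      hf (2 * n + 1) (odd_two_mul_add_one n), add_zero, Finset.sum_range_succ]

theorem sqrt_mul_integral_sum_mul_exp {t : ℝ} (ht : 0 < t) (c : ℕ → ℝ) (n : ℕ) :
    √t * ∫ y : ℝ, (∑ k ∈ Finset.range (2 * n), c k * y ^ k) * Real.exp (-(t * (1 / 2)) * y ^ 2) =
      √(2 * Real.pi) *
        ∑ k ∈ Finset.range n, 1 / t ^ k * (c (2 * k) * ((2 * k)! / (2 ^ k * k !))) := by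
  simp_rw [Finset.sum_mul, mul_assoc (c _)]
  rw [MeasureTheory.integral_finsetSum _ fun k _ =>
    (integrable_pow_mul_exp_neg_mul_sq (by positivity) k).const_mul _]
  simp_rw [MeasureTheory.integral_const_mul]
  rw [sum_range_two_mul_of_odd_eq_zero
      fun k hk => by rw [integral_odd_pow_mul_exp_neg_mul_sq _ hk, mul_zero],
    Finset.mul_sum, Finset.mul_sum]
  refine Finset.sum_congr rfl fun k _ => ?_
  have h := sqrt_pow_mul_integral_pow_mul_exp ht (1 / 2) (2 * k)
  rw [integral_even_pow_mul_exp_neg_sq_div_two, pow_succ, pow_mul, Real.sq_sqrt ht.le] at h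
  rw [mul_left_comm (√(2 * Real.pi)), mul_left_comm (√(2 * Real.pi)), ← h]
  field_simp

theorem isFactorialExpansion_factorialCoeff : IsFactorialExpansion factorialCoeff := by
  intro N
  refine ⟨fun n => (n ! : ℝ) / (Real.sqrt (2 * Real.pi * n) * Real.exp (-(n : ℝ)) * (n : ℝ) ^ n) -
    ∑ k ∈ Finset.range (N + 1), 1 / (n : ℝ) ^ k * factorialCoeff k, fun n hn => ?_, ?_⟩
  · have hn0 : (0 : ℝ) < n := by exact_mod_cast hn
    rw [add_sub_cancel, mul_div_cancel₀]
    positivity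
  -- M = 2(N+1) is even, as the moment bounds require, and √n·n^{-(M+1)/2} = n^{-(N+1)} is the
  -- required order.
  · obtain ⟨C, hC⟩ := exists_abs_integral_exp_sub_integral_le (even_two_mul (N + 1))
    refine IsBigO.of_bound (C / √(2 * Real.pi)) ?_
    filter_upwards [eventually_ge_atTop 1] with n hn
    have hn0 : (0 : ℝ) < n := by exact_mod_cast hn
    have h := hC n (by exact_mod_cast hn)
    have hs : √(n : ℝ) ^ 2 = n := Real.sq_sqrt hn0.le
    have hs0 : 0 < √(n : ℝ) := Real.sqrt_pos.2 hn0
    have hpi : 0 < √(2 * Real.pi) := Real.sqrt_pos.2 (by positivity)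
    have hsum := sqrt_mul_integral_sum_mul_exp hn0
      (fun k => taylorCoeffZero k (fun x => (truncLog x ^ (1 / 2 : ℝ))⁻¹ ^ (k + 1))) (N + 1)
    simp only [taylorCoeffZero_inv_sqrt_truncLog_pow] at hsum
    rw [factorial_eq_integral_exp hn, Real.sqrt_mul (by positivity)]
    set I := ∫ x in Set.Ioi (-1 : ℝ), Real.exp (-(n * (x - Real.log (1 + x))))
    set J := ∫ y : ℝ, (∑ k ∈ Finset.range (2 * (N + 1)),
          taylorCoeffZero k (fun x => (truncLog x ^ (1 / 2 : ℝ))⁻¹ ^ (k + 1)) * y ^ k) *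
            Real.exp (-((n : ℝ) * (1 / 2)) * y ^ 2)
    have e : (n : ℝ) * (n : ℝ) ^ n * Real.exp (-(n : ℝ)) * I /
        (√(2 * Real.pi) * √(n : ℝ) * Real.exp (-(n : ℝ)) * (n : ℝ) ^ n) -
        ∑ k ∈ Finset.range (N + 1), 1 / (n : ℝ) ^ k * factorialCoeff k =
        √(n : ℝ) * (I - J) / √(2 * Real.pi) := by
      rw [mul_sub, hsum]
      field_simp
      linear_combination (-I) * hs
    rw [e, Real.norm_eq_abs, Real.norm_of_nonneg (by positivity), abs_div, abs_mul,
      abs_of_pos hs0, abs_of_pos hpi, div_mul_eq_mul_div]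
    refine div_le_div_of_nonneg_right ?_ hpi.le
    rw [mul_one_div, le_div_iff₀ (by positivity)]
    refine le_trans (le_of_eq ?_) h
    rw [pow_succ (√(n : ℝ)), pow_mul, hs]
    ring

theorem IsFactorialExpansion.unique {a b : ℕ → ℝ} (ha : IsFactorialExpansion a)
    (hb : IsFactorialExpansion b) : a = b := by
  funext N
  induction N using Nat.strong_induction_on with
  | _ N ih =>
    obtain ⟨R, hR, hRO⟩ := ha N
    obtain ⟨S, hS, hSO⟩ := hb N
    have h1 : (fun n : ℕ => 1 / (n : ℝ) ^ N * (a N - b N)) =ᶠ[atTop] fun n => S n - R n := by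
      filter_upwards [eventually_ge_atTop 1] with n hn
      have hn0 : (0 : ℝ) < n := by exact_mod_cast hn
      have h := (hR n hn).symm.trans (hS n hn)
      have h := mul_left_cancel₀ (by positivity) h
      rw [Finset.sum_range_succ, Finset.sum_range_succ,
        Finset.sum_congr rfl fun k hk => by rw [ih k (Finset.mem_range.1 hk)]] at h
      linarith
    have h2 : (fun n : ℕ => 1 / (n : ℝ) ^ N * (a N - b N)) =O[atTop]
        fun n : ℕ => 1 / (n : ℝ) ^ (N + 1) := h1.trans_isBigO (hSO.sub hRO)
    -- Multiplying by n^N makes the constant a N - b N of size O(1/n), hence zero.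
    have h3 : (fun _ : ℕ => a N - b N) =O[atTop] fun n : ℕ => 1 / (n : ℝ) := by
      refine ((isBigO_refl (fun n : ℕ => (n : ℝ) ^ N) atTop).mul h2).congr' ?_ ?_
      · filter_upwards [eventually_ge_atTop 1] with n hn
        have hn0 : (0 : ℝ) < n := by exact_mod_cast hn
        field_simp
      · filter_upwards [eventually_ge_atTop 1] with n hn
        have hn0 : (0 : ℝ) < n := by exact_mod_cast hn
        rw [pow_succ]
        field_simp
    have h4 := h3.trans_tendsto tendsto_one_div_atTop_nhds_zero_nat
    exact sub_eq_zero.1 (tendsto_nhds_unique tendsto_const_nhds h4)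

theorem theorem3 :
    (∀ x : ℝ, |x| < 1 →
      HasSum (fun j : ℕ => 2 * ((-1 : ℝ) ^ j * x ^ j / ((j : ℝ) + 2))) (truncLog x)) ∧
    (∀ k : ℕ, AnalyticAt ℝ (fun x : ℝ => truncLog x ^ (-((2 * (k : ℝ) + 1) / 2))) 0) ∧
    (∀ a : ℕ → ℝ, IsFactorialExpansion a ↔
      ∀ k : ℕ, a k = 1 / (2 ^ k * (k ! : ℝ)) *
        iteratedDeriv (2 * k) (fun x : ℝ => truncLog x ^ (-((2 * (k : ℝ) + 1) / 2))) 0) := by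
  refine ⟨fun x hx => hasSum_truncLog hx,
    fun k => analyticAt_truncLog.rpow_const_of_pos (by simp [truncLog_zero]) _, fun a => ⟨?_, ?_⟩⟩
  · intro ha k
    rw [ha.unique isFactorialExpansion_factorialCoeff, factorialCoeff]
  · intro h
    rw [show a = factorialCoeff from funext h]
    exact isFactorialExpansion_factorialCoeff
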